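/- For $n\ge 0$ let the $n\times n$ grid be the graph on the points $(i,j)\in\mathbb{Z}^2$, $0\le i,j<n$, with edges joining the points at unit distance. Let $m$ and $n$ be nonnegative integers with $m\le n/2$, choose any of the four corners of the $n\times n$ grid, and let $D$ be the set of the first $m$ vertices of the diagonal that starts at this corner and runs towards the centre; for the corner $(0,0)$ this is $D=\{(i,i):0\le i<m\}$, and for the other corners it is a mirror image of this set. Let $G$ be the subgraph of the grid induced by the vertices not in $D$. Then: 1. $|D|=m$. 2. If $n\ge 2$, then $G$ has pathwidth exactly $n-m$. 3. The largest square grid that is a minor of $G$ is exactly $(n-m)\times(n-m)$; that is, $n-m$ is the largest integer $k\ge 0$ such that the $k\times k$ grid is a minor of $G$. Here a path decomposition of a graph is a finite sequence of vertex sets (bags) such that every vertex lies in at least one bag, the bags containing any given vertex are consecutive, and the two endpoints of every edge lie in a common bag; its width is one less than the size of its largest bag, and the pathwidth of the graph is the minimum width of its path decompositions. A graph $H$ is a minor of $G$ if it is obtained from $G$ (up to isomorphism) by vertex deletions, edge deletions and edge contractions. -/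

import Mathlib

open SimpleGraph

/-- The `n × n` grid graph: its vertices are the lattice points `(i, j)` with `0 ≤ i, j < n`, and
its edges join the points at unit distance. -/
abbrev gridGraph (n : ℕ) : SimpleGraph (Fin n × Fin n) :=
  pathGraph n □ pathGraph n

/-- The graph left of the `n × n` grid after the deletion of the vertices in `D`. -/
abbrev damagedGrid (n : ℕ) (D : Finset (Fin n × Fin n)) : SimpleGraph {v // v ∉ D} :=
  (gridGraph n).induce {v | v ∉ D}

/-- `H` is a minor of `G`: there are disjoint vertex sets of `G`, one for each vertex of `H`, each
inducing a connected (hence nonempty) subgraph, such that adjacent vertices of `H` belong to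
sets joined by an edge of `G`.  Contracting the sets and deleting what is left over gives `H`. -/
def IsGraphMinor {W V : Type*} (H : SimpleGraph W) (G : SimpleGraph V) : Prop :=
  ∃ B : W → Set V,
    (∀ w, (G.induce (B w)).Connected) ∧
    (∀ u w, u ≠ w → Disjoint (B u) (B w)) ∧
    (∀ u w, H.Adj u w → ∃ x ∈ B u, ∃ y ∈ B w, G.Adj x y)

/-- A path decomposition of `G`: a finite sequence of bags such that every vertex lies in some bag,
the bags holding a given vertex are contiguous, and every edge has both ends in a common bag. -/
structure PathDecomposition {V : Type*} (G : SimpleGraph V) where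
  /-- the number of bags -/
  length : ℕ
  /-- the bags -/
  bag : Fin length → Finset V
  exists_mem : ∀ v, ∃ i, v ∈ bag i
  contiguous : ∀ v i j k, i ≤ j → j ≤ k → v ∈ bag i → v ∈ bag k → v ∈ bag j
  exists_adj : ∀ u v, G.Adj u v → ∃ i, u ∈ bag i ∧ v ∈ bag i

/-- The width of a path decomposition: one less than the size of its largest bag. -/
def PathDecomposition.width {V : Type*} {G : SimpleGraph V} (P : PathDecomposition G) : ℤ :=
  ((Finset.univ.sup fun i => (P.bag i).card : ℕ) : ℤ) - 1

/-- The pathwidth of `G`, the minimum width of its path decompositions, exists and equals `w`. -/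
def HasPathwidth {V : Type*} (G : SimpleGraph V) (w : ℤ) : Prop :=
  IsLeast (Set.range (PathDecomposition.width (G := G))) w

/-- The first `m` vertices of the diagonal that starts at a corner of the `n × n` grid.  The corner
is the one with first coordinate `n - 1` if `a` is true and `0` otherwise, and with second
coordinate `n - 1` if `b` is true and `0` otherwise. -/
def cornerDiagonal (n m : ℕ) (a b : Bool) : Finset (Fin n × Fin n) :=
  (Finset.univ.filter fun i : Fin n => (i : ℕ) < m).image fun i =>
    (if a then i.rev else i, if b then i.rev else i)

/-! Measure coordinates `x`, `y` from the chosen corner. The concentric square rings around the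
point (m - 1/2, m - 1/2) divide the grid into n - m classes, since 2m ≤ n. Each of the m inner rings
loses exactly one corner to the deleted diagonal and so opens into a path; each outer ring is
already cut to an L by the boundary. A front with one vertex per ring can therefore rotate from one
side of the diagonal to the other. Bags hold this front and one new vertex, which gives width at
most n - m (`exists_pathDecomposition_damagedGrid`).

Conversely, the subgrid with both coordinates at least m survives, so the k × k grid with k = n - m
is a minor. For k ≥ 2 that grid has a bramble of order at least k + 1. Its members lift through the
branch sets to pairwise touching connected sets, some bag meets them all, and disjointness of the
branch sets makes that bag have at least k + 1 vertices (`IsGraphMinor.le_width`). The same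
inequality, applied to the decomposition of width at most n - m, excludes larger grid minors. -/

/-! ### Path decompositions from layouts -/

/-- A layout of the vertices by times and `k` lanes, in which a vertex is finished (all its
neighbours are placed) as soon as a later vertex of its lane is placed, yields a path decomposition
of width at most `k`. -/
theorem exists_pathDecomposition_width_le {V : Type*} [Fintype V] (G : SimpleGraph V) (k : ℕ)
    (time lane : V → ℕ) (hlane : ∀ v, lane v < k)
    (hinj : ∀ u v, lane u = lane v → time u = time v → u = v)
    (hdone : ∀ u v w, lane u = lane v → time u < time v → G.Adj u w → w = v ∨ time w < time v) :
    ∃ P : PathDecomposition G, P.width ≤ k := by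
  classical
  let N := Fintype.card V
  let e : V ≃ Fin N := Fintype.equivFin V
  -- Ties in `time` are broken by an arbitrary enumeration, giving a linear order.
  let f : V → ℕ := fun v => time v * N + e v
  have f_lt : ∀ u v, time u < time v → f u < f v := by
    intro u v h
    have h1 : (time u + 1) * N ≤ time v * N := Nat.mul_le_mul_right _ h
    have h2 := (e u).isLt
    simp only [f]
    rw [add_mul] at h1
    omega
  have f_inj : ∀ u v, f u = f v → u = v := by
    intro u v h
    rcases lt_trichotomy (time u) (time v) with h1 | h1 | h1
    · exact absurd h (f_lt _ _ h1).ne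
    · simp only [f, h1] at h
      exact e.injective (Fin.ext (by omega))
    · exact absurd h (f_lt _ _ h1).ne'
  have f_done : ∀ u v w, lane u = lane v → f u < f v → G.Adj u w → f w ≤ f v := by
    intro u v w hl hf hw
    have ht : time u < time v := by
      rcases lt_trichotomy (time u) (time v) with h1 | h1 | h1
      · exact h1
      · rw [hinj u v hl h1] at hf
        exact absurd hf (lt_irrefl _)
      · exact absurd hf (f_lt _ _ h1).not_gt
    rcases hdone u v w hl ht hw with rfl | h
    · exact le_rfl
    · exact (f_lt _ _ h).le
  let P : PathDecomposition G :=
    { length := (Finset.univ.sup f) + 1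
      bag := fun t => Finset.univ.filter fun u =>
        f u ≤ t ∧ (f u = t ∨ ∃ w, G.Adj u w ∧ (t : ℕ) ≤ f w)
      exists_mem := fun v =>
        ⟨⟨f v, Nat.lt_succ_of_le (Finset.le_sup (Finset.mem_univ v))⟩, by simp⟩
      contiguous := by
        intro v i j l hij hjl hi hl
        have hij' : (i : ℕ) ≤ j := hij
        have hjl' : (j : ℕ) ≤ l := hjl
        simp only [Finset.mem_filter, Finset.mem_univ, true_and] at hi hl ⊢
        refine ⟨by omega, ?_⟩
        rcases hl.2 with h | ⟨w, hw, h⟩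
        · left; omega
        · exact Or.inr ⟨w, hw, by omega⟩
      exists_adj := by
        intro u v huv
        rcases le_total (f u) (f v) with h | h
        · refine ⟨⟨f v, Nat.lt_succ_of_le (Finset.le_sup (Finset.mem_univ v))⟩, ?_⟩
          simp only [Finset.mem_filter, Finset.mem_univ, true_and, le_refl, true_or, and_true]
          exact ⟨h, Or.inr ⟨v, huv, le_rfl⟩⟩
        · refine ⟨⟨f u, Nat.lt_succ_of_le (Finset.le_sup (Finset.mem_univ u))⟩, ?_⟩
          simp only [Finset.mem_filter, Finset.mem_univ, true_and, le_refl, true_or]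
          exact ⟨h, Or.inr ⟨u, huv.symm, le_rfl⟩⟩ }
  have hcard : ∀ t, (P.bag t).card ≤ k + 1 := by
    intro t
    rw [← Finset.card_range (k + 1)]
    -- The newest vertex takes the extra value `k`. Two older vertices cannot share a lane: the
    -- earlier would have all its neighbours placed before `t`, so it would have left the bag.
    refine Finset.card_le_card_of_injOn (fun u => if f u = t then k else lane u) ?_ ?_
    · intro u _
      have := hlane u
      simp only [Finset.coe_range, Set.mem_Iio]
      split_ifs <;> omega
    · intro u hu v hv huv
      simp only [P, Finset.coe_filter, Finset.mem_univ, true_and, Set.mem_ofPred_eq] at hu hv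
      have h1 := hlane u
      have h2 := hlane v
      by_cases h3 : f u = t <;> by_cases h4 : f v = t <;>
        simp only [h3, h4, if_true, if_false] at huv
      · exact f_inj _ _ (h3.trans h4.symm)
      · omega
      · omega
      · obtain ⟨w, hw, hwt⟩ := hu.2.resolve_left h3
        obtain ⟨w', hw', hwt'⟩ := hv.2.resolve_left h4
        rcases lt_trichotomy (f u) (f v) with h | h | h
        · have := f_done u v w huv h hw
          omega
        · exact f_inj _ _ h
        · have := f_done v u w' huv.symm h hw'
          omega
  refine ⟨P, ?_⟩
  have : (Finset.univ.sup fun i => (P.bag i).card) ≤ k + 1 :=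
    Finset.sup_le fun t _ => hcard t
  simp only [PathDecomposition.width]
  omega

/-! ### Bags and connected sets -/

theorem PathDecomposition.card_bag_le {V : Type*} {G : SimpleGraph V} (P : PathDecomposition G)
    (t : Fin P.length) : ((P.bag t).card : ℤ) ≤ P.width + 1 := by
  have : (P.bag t).card ≤ Finset.univ.sup fun i => (P.bag i).card :=
    Finset.le_sup (f := fun i => (P.bag i).card) (Finset.mem_univ t)
  simp only [PathDecomposition.width]
  omega

/-- The bags that meet a connected set are contiguous. -/
theorem PathDecomposition.contiguous_of_connected {V : Type*} {G : SimpleGraph V}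
    (P : PathDecomposition G) {X : Set V} (hX : (G.induce X).Connected) {i j l : Fin P.length}
    (hij : i ≤ j) (hjl : j ≤ l) (hi : ∃ x ∈ X, x ∈ P.bag i) (hl : ∃ x ∈ X, x ∈ P.bag l) :
    ∃ x ∈ X, x ∈ P.bag j := by
  by_contra! hj
  obtain ⟨x, hx, hxi⟩ := hi
  obtain ⟨y, hy, hyl⟩ := hl
  -- If bag `j` misses `X`, the bags of each vertex of `X` lie on one side of `j`; an edge within
  -- `X` cannot change the side.
  have before : ∀ z ∈ X, ∀ s, z ∈ P.bag s → s < j → ∀ t, z ∈ P.bag t → t < j := by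
    intro z hz s hs hsj t ht
    by_contra! h
    exact hj z hz (P.contiguous z s j t hsj.le h hs ht)
  have key : ∀ u v : X, (G.induce X).Reachable u v → (∃ s, u.1 ∈ P.bag s ∧ s < j) →
      ∃ s, v.1 ∈ P.bag s ∧ s < j := by
    rintro u v ⟨p⟩
    induction p with
    | nil => exact id
    | @cons a b c hab _ ih =>
      rintro ⟨s, hs, hsj⟩
      obtain ⟨t, hta, htb⟩ := P.exists_adj a.1 b.1 hab
      exact ih ⟨t, htb, before a.1 a.2 s hs hsj t hta⟩
  have hne : i ≠ j := fun h => hj x hx (h ▸ hxi)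
  obtain ⟨s, hs, hsj⟩ := key ⟨x, hx⟩ ⟨y, hy⟩ (hX.preconnected _ _)
    ⟨i, hxi, lt_of_le_of_ne hij hne⟩
  exact absurd (before y hy s hs hsj l hyl) hjl.not_gt

/-- Some bag meets every member of a family of pairwise touching connected sets. -/
theorem PathDecomposition.exists_bag_meets {V ι : Type*} [Nonempty ι] {G : SimpleGraph V}
    (P : PathDecomposition G) (X : ι → Set V) (hconn : ∀ i, (G.induce (X i)).Connected)
    (htouch : ∀ i j, ∃ x ∈ X i, ∃ y ∈ X j, x = y ∨ G.Adj x y) :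
    ∃ t, ∀ i, ∃ x ∈ X i, x ∈ P.bag t := by
  have hlast : ∀ i, ∃ t, (∃ x ∈ X i, x ∈ P.bag t) ∧
      ∀ s, (∃ x ∈ X i, x ∈ P.bag s) → s ≤ t := by
    intro i
    obtain ⟨⟨x, hx⟩⟩ := (hconn i).nonempty
    obtain ⟨t, ht⟩ := P.exists_mem x
    obtain ⟨t', ht', hmax⟩ := Set.exists_max_image {t | ∃ x ∈ X i, x ∈ P.bag t} id
      (Set.toFinite _) ⟨t, x, hx, ht⟩
    exact ⟨t', ht', hmax⟩
  choose last hmeet hmax using hlast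
  -- Helly property of intervals: take the set whose last bag comes earliest. Every other set
  -- touches it no later than that bag and ends no earlier.
  obtain ⟨t, ⟨i, rfl⟩, hmin⟩ := Set.exists_min_image (Set.range last) id (Set.toFinite _)
    (Set.range_nonempty last)
  refine ⟨last i, fun j => ?_⟩
  obtain ⟨x, hx, y, hy, hxy⟩ := htouch i j
  obtain ⟨s, hsx, hsy⟩ : ∃ s, x ∈ P.bag s ∧ y ∈ P.bag s := by
    rcases hxy with rfl | h
    · obtain ⟨s, hs⟩ := P.exists_mem x
      exact ⟨s, hs, hs⟩
    · exact P.exists_adj x y h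
  exact P.contiguous_of_connected (hconn j) (hmax i s ⟨x, hx, hsx⟩) (hmin _ ⟨j, rfl⟩)
    ⟨y, hy, hsy⟩ (hmeet j)

/-! ### Connected sets and branch sets -/

/-- A set is connected if each of its vertices other than `r` has a neighbour in the set at which
`μ` is smaller. -/
theorem connected_induce_of_descent {V : Type*} (G : SimpleGraph V) (S : Set V) (r : V)
    (hr : r ∈ S) (μ : V → ℕ)
    (h : ∀ v ∈ S, v ≠ r → ∃ w ∈ S, G.Adj v w ∧ μ w < μ v) : (G.induce S).Connected := by
  have key : ∀ c, ∀ v : S, μ v = c → (G.induce S).Reachable v ⟨r, hr⟩ := by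
    intro c
    induction c using Nat.strong_induction_on with
    | _ c ih =>
      rintro ⟨v, hv⟩ hc
      by_cases hvr : v = r
      · subst hvr
        exact Reachable.refl _
      · obtain ⟨w, hw, hadj, hlt⟩ := h v hv hvr
        have hadj' : (G.induce S).Adj ⟨v, hv⟩ ⟨w, hw⟩ := hadj
        exact hadj'.reachable.trans (ih (μ w) (hc ▸ hlt) ⟨w, hw⟩ rfl)
  exact { preconnected := fun u v => (key _ u rfl).trans (key _ v rfl).symm
          nonempty := ⟨⟨r, hr⟩⟩ }

/-- The union of the branch sets over a connected set is connected. -/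
theorem connected_induce_biUnion {W V : Type*} {H : SimpleGraph W} {G : SimpleGraph V}
    {B : W → Set V} (hB : ∀ w, (G.induce (B w)).Connected)
    (hadj : ∀ u w, H.Adj u w → ∃ x ∈ B u, ∃ y ∈ B w, G.Adj x y)
    {S : Set W} (hS : (H.induce S).Connected) :
    (G.induce (⋃ w ∈ S, B w)).Connected := by
  have hsub : ∀ w ∈ S, B w ⊆ ⋃ w ∈ S, B w := fun w hw => Set.subset_biUnion_of_mem hw
  have inside : ∀ w (hw : w ∈ S) x (hx : x ∈ B w) y (hy : y ∈ B w),
      (G.induce (⋃ w ∈ S, B w)).Reachable ⟨x, hsub w hw hx⟩ ⟨y, hsub w hw hy⟩ := by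
    intro w hw x hx y hy
    exact ((hB w).preconnected ⟨x, hx⟩ ⟨y, hy⟩).map (induceHomOfLE G (hsub w hw)).toHom
  have key : ∀ u v : S, (H.induce S).Reachable u v → ∀ x (hx : x ∈ B u) y (hy : y ∈ B v),
      (G.induce (⋃ w ∈ S, B w)).Reachable ⟨x, hsub u u.2 hx⟩ ⟨y, hsub v v.2 hy⟩ := by
    rintro u v ⟨p⟩
    induction p with
    | @nil u => exact inside u u.2
    | @cons a b c hab _ ih =>
      intro x hx y hy
      obtain ⟨x', hx', y', hy', h⟩ := hadj a.1 b.1 hab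
      have h' : (G.induce (⋃ w ∈ S, B w)).Adj ⟨x', hsub a a.2 hx'⟩ ⟨y', hsub b b.2 hy'⟩ := h
      exact ((inside a a.2 x hx x' hx').trans h'.reachable).trans (ih y' hy' y hy)
  obtain ⟨w, hw⟩ := hS.nonempty
  obtain ⟨x, hx⟩ := (hB w).nonempty
  refine { preconnected := ?_, nonempty := ⟨⟨x, hsub w hw hx⟩⟩ }
  rintro ⟨x, hx⟩ ⟨y, hy⟩
  obtain ⟨u, hu, hxu⟩ := Set.mem_iUnion₂.1 hx
  obtain ⟨v, hv, hyv⟩ := Set.mem_iUnion₂.1 hy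
  exact key ⟨u, hu⟩ ⟨v, hv⟩ (hS.preconnected _ _) x hxu y hyv

/-! ### The grid bramble -/

theorem gridGraph_adj {n : ℕ} (u v : Fin n × Fin n) :
    (gridGraph n).Adj u v ↔
      ((u.1 : ℕ) = v.1 ∧ ((u.2 : ℕ) + 1 = v.2 ∨ (v.2 : ℕ) + 1 = u.2)) ∨
      ((u.2 : ℕ) = v.2 ∧ ((u.1 : ℕ) + 1 = v.1 ∨ (v.1 : ℕ) + 1 = u.1)) := by
  simp only [gridGraph, boxProd_adj, pathGraph_adj, Fin.ext_iff]
  tauto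

/-- Members of a bramble of the `(q + 2) × (q + 2)` grid: the crosses of the
`(q + 1) × (q + 1)` subgrid, the last row, and the last column without its last vertex. -/
def gridBramble (q : ℕ) : Option (Option (Fin (q + 1) × Fin (q + 1))) →
    Set (Fin (q + 2) × Fin (q + 2))
  | none => {v | (v.1 : ℕ) = q + 1}
  | some none => {v | (v.2 : ℕ) = q + 1 ∧ (v.1 : ℕ) < q + 1}
  | some (some c) => {v | (v.1 : ℕ) < q + 1 ∧ (v.2 : ℕ) < q + 1 ∧
      ((v.1 : ℕ) = c.1 ∨ (v.2 : ℕ) = c.2)}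

theorem mem_gridBramble_row {q : ℕ} {v : Fin (q + 2) × Fin (q + 2)} :
    v ∈ gridBramble q none ↔ (v.1 : ℕ) = q + 1 := Iff.rfl

theorem mem_gridBramble_col {q : ℕ} {v : Fin (q + 2) × Fin (q + 2)} :
    v ∈ gridBramble q (some none) ↔ (v.2 : ℕ) = q + 1 ∧ (v.1 : ℕ) < q + 1 := Iff.rfl

theorem mem_gridBramble_cross {q : ℕ} {c : Fin (q + 1) × Fin (q + 1)}
    {v : Fin (q + 2) × Fin (q + 2)} : v ∈ gridBramble q (some (some c)) ↔
      (v.1 : ℕ) < q + 1 ∧ (v.2 : ℕ) < q + 1 ∧ ((v.1 : ℕ) = c.1 ∨ (v.2 : ℕ) = c.2) := Iff.rfl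

theorem connected_gridBramble (q : ℕ) (i : Option (Option (Fin (q + 1) × Fin (q + 1)))) :
    ((gridGraph (q + 2)).induce (gridBramble q i)).Connected := by
  rcases i with _ | _ | ⟨⟨a, ha⟩, ⟨b, hb⟩⟩
  · refine connected_induce_of_descent _ _ (⟨q + 1, by omega⟩, ⟨0, by omega⟩)
      (by simp [gridBramble]) (fun v => v.2) ?_
    rintro ⟨⟨x, hx⟩, ⟨y, hy⟩⟩ hv hne
    simp only [gridBramble, Set.mem_ofPred_eq] at hv
    simp only [ne_eq, Prod.mk.injEq, Fin.mk.injEq] at hne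
    refine ⟨(⟨x, hx⟩, ⟨y - 1, by omega⟩), ?_, ?_, ?_⟩
    · simpa [gridBramble] using hv
    · rw [gridGraph_adj]; dsimp only; omega
    · simp only; omega
  · refine connected_induce_of_descent _ _ (⟨0, by omega⟩, ⟨q + 1, by omega⟩)
      (by simp [gridBramble]) (fun v => v.1) ?_
    rintro ⟨⟨x, hx⟩, ⟨y, hy⟩⟩ hv hne
    simp only [gridBramble, Set.mem_ofPred_eq] at hv
    simp only [ne_eq, Prod.mk.injEq, Fin.mk.injEq] at hne
    refine ⟨(⟨x - 1, by omega⟩, ⟨y, hy⟩), ?_, ?_, ?_⟩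
    · simp only [gridBramble, Set.mem_ofPred_eq]; omega
    · rw [gridGraph_adj]; dsimp only; omega
    · simp only; omega
  · refine connected_induce_of_descent _ _ (⟨a, by omega⟩, ⟨b, by omega⟩)
      (mem_gridBramble_cross.2 ⟨ha, hb, Or.inl rfl⟩)
      (fun v => (v.1 - a) + (a - v.1) + ((v.2 - b) + (b - v.2))) ?_
    rintro ⟨⟨x, hx⟩, ⟨y, hy⟩⟩ hv hne
    simp only [gridBramble, Set.mem_ofPred_eq] at hv
    simp only [ne_eq, Prod.mk.injEq, Fin.mk.injEq] at hne
    -- On the cross only one coordinate differs from the centre, so this is a single step towards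
    -- it.
    refine ⟨(⟨if x < a then x + 1 else if a < x then x - 1 else x, by split_ifs <;> omega⟩,
      ⟨if y < b then y + 1 else if b < y then y - 1 else y, by split_ifs <;> omega⟩), ?_, ?_, ?_⟩
    · simp only [gridBramble, Set.mem_ofPred_eq]; split_ifs <;> omega
    · rw [gridGraph_adj]; dsimp only; split_ifs <;> omega
    · simp only; split_ifs <;> omega

theorem gridBramble_touch (q : ℕ) (i j : Option (Option (Fin (q + 1) × Fin (q + 1)))) :
    ∃ u ∈ gridBramble q i, ∃ v ∈ gridBramble q j, u = v ∨ (gridGraph (q + 2)).Adj u v := by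
  have touch_of_adj : ∀ {i j}, ∀ u ∈ gridBramble q i, ∀ v ∈ gridBramble q j,
      (gridGraph (q + 2)).Adj u v → (∃ u ∈ gridBramble q i, ∃ v ∈ gridBramble q j,
        u = v ∨ (gridGraph (q + 2)).Adj u v) ∧ ∃ u ∈ gridBramble q j, ∃ v ∈ gridBramble q i,
        u = v ∨ (gridGraph (q + 2)).Adj u v :=
    fun u hu v hv h => ⟨⟨u, hu, v, hv, Or.inr h⟩, ⟨v, hv, u, hu, Or.inr h.symm⟩⟩
  have self : ∀ i, ∃ u ∈ gridBramble q i, ∃ v ∈ gridBramble q i,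
      u = v ∨ (gridGraph (q + 2)).Adj u v := by
    intro i
    obtain ⟨u, hu⟩ := (connected_gridBramble q i).nonempty
    exact ⟨u, hu, u, hu, Or.inl rfl⟩
  have row_col := @touch_of_adj none (some none)
    (⟨q + 1, by omega⟩, ⟨q + 1, by omega⟩) (mem_gridBramble_row.2 rfl)
    (⟨q, by omega⟩, ⟨q + 1, by omega⟩) (mem_gridBramble_col.2 ⟨rfl, Nat.lt_succ_self q⟩)
    ((gridGraph_adj _ _).2 (Or.inr ⟨rfl, Or.inr rfl⟩))
  have cross_row := fun c => @touch_of_adj (some (some c)) none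
    (⟨q, by omega⟩, c.2.castSucc)
    (mem_gridBramble_cross.2 ⟨Nat.lt_succ_self q, c.2.isLt, Or.inr rfl⟩)
    (⟨q + 1, by omega⟩, c.2.castSucc) (mem_gridBramble_row.2 rfl)
    ((gridGraph_adj _ _).2 (Or.inr ⟨rfl, Or.inl rfl⟩))
  have cross_col := fun c => @touch_of_adj (some (some c)) (some none)
    (c.1.castSucc, ⟨q, by omega⟩)
    (mem_gridBramble_cross.2 ⟨c.1.isLt, Nat.lt_succ_self q, Or.inl rfl⟩)
    (c.1.castSucc, ⟨q + 1, by omega⟩) (mem_gridBramble_col.2 ⟨rfl, c.1.isLt⟩)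
    ((gridGraph_adj _ _).2 (Or.inl ⟨rfl, Or.inl rfl⟩))
  rcases i with _ | _ | c <;> rcases j with _ | _ | d
  · exact self _
  · exact row_col.1
  · exact (cross_row d).2
  · exact row_col.2
  · exact self _
  · exact (cross_col d).2
  · exact (cross_row c).1
  · exact (cross_col c).1
  · exact ⟨(c.1.castSucc, d.2.castSucc),
      mem_gridBramble_cross.2 ⟨c.1.isLt, d.2.isLt, Or.inl rfl⟩, (c.1.castSucc, d.2.castSucc),
      mem_gridBramble_cross.2 ⟨c.1.isLt, d.2.isLt, Or.inr rfl⟩, Or.inl rfl⟩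

/-- If `T` missed a row and a column of the subgrid, it would miss their cross. So it has q + 1
vertices there, and two more in the last row and the shortened last column, which are disjoint from
the subgrid and from each other. -/
theorem le_card_of_meets_gridBramble (q : ℕ) (T : Finset (Fin (q + 2) × Fin (q + 2)))
    (hT : ∀ i, ∃ u ∈ gridBramble q i, u ∈ T) : q + 3 ≤ T.card := by
  obtain ⟨r, hr, hrT⟩ := hT none
  obtain ⟨c, hc, hcT⟩ := hT (some none)
  simp only [gridBramble, Set.mem_ofPred_eq] at hr hc
  have hlines : (∀ a : Fin (q + 1), ∃ u ∈ T, (u.1 : ℕ) = a ∧ (u.2 : ℕ) < q + 1) ∨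
      (∀ b : Fin (q + 1), ∃ u ∈ T, (u.2 : ℕ) = b ∧ (u.1 : ℕ) < q + 1) := by
    by_contra! h
    obtain ⟨⟨a, ha⟩, ⟨b, hb⟩⟩ := h
    obtain ⟨u, ⟨hu1, hu2, hu⟩, huT⟩ := hT (some (some (a, b)))
    rcases hu with hu | hu
    · exact absurd (ha u huT hu) (by omega)
    · exact absurd (hb u huT hu) (by omega)
  obtain ⟨g, hgT, hg, hinj⟩ : ∃ g : Fin (q + 1) → Fin (q + 2) × Fin (q + 2), (∀ a, g a ∈ T) ∧
      (∀ a, ((g a).1 : ℕ) < q + 1 ∧ ((g a).2 : ℕ) < q + 1) ∧ Function.Injective g := by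
    rcases hlines with h | h
    · choose g h1 h2 h3 using h
      exact ⟨g, h1, fun a => ⟨by rw [h2]; exact a.2, h3 a⟩,
        fun a b hab => Fin.ext (by rw [← h2 a, ← h2 b, hab])⟩
    · choose g h1 h2 h3 using h
      exact ⟨g, h1, fun a => ⟨h3 a, by rw [h2]; exact a.2⟩,
        fun a b hab => Fin.ext (by rw [← h2 a, ← h2 b, hab])⟩
  have hcard : (Finset.univ.image g).card = q + 1 := by
    rw [Finset.card_image_of_injective _ hinj, Finset.card_univ, Fintype.card_fin]
  have hc' : c ∉ Finset.univ.image g := by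
    simp only [Finset.mem_image, Finset.mem_univ, true_and, not_exists]
    rintro a rfl
    have := hg a
    omega
  have hr' : r ∉ insert c (Finset.univ.image g) := by
    simp only [Finset.mem_insert, Finset.mem_image, Finset.mem_univ, true_and, not_or, not_exists]
    constructor
    · rintro rfl
      omega
    · rintro a rfl
      have := hg a
      omega
  have hsub : insert r (insert c (Finset.univ.image g)) ⊆ T := by
    intro u hu
    simp only [Finset.mem_insert, Finset.mem_image, Finset.mem_univ, true_and] at hu
    rcases hu with rfl | rfl | ⟨a, rfl⟩
    exacts [hrT, hcT, hgT a]
  have := Finset.card_le_card hsub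
  rw [Finset.card_insert_of_notMem hr', Finset.card_insert_of_notMem hc', hcard] at this
  exact this

/-- A path decomposition of a graph with a `k × k` grid minor has width at least `k`. -/
theorem IsGraphMinor.le_width {V : Type*} {G : SimpleGraph V} {k : ℕ} (hk : 2 ≤ k)
    (h : IsGraphMinor (gridGraph k) G) (P : PathDecomposition G) : (k : ℤ) ≤ P.width := by
  classical
  obtain ⟨q, rfl⟩ : ∃ q, k = q + 2 := ⟨k - 2, by omega⟩
  obtain ⟨B, hconn, hdisj, hadj⟩ := h
  obtain ⟨t, ht⟩ := P.exists_bag_meets (fun i => ⋃ w ∈ gridBramble q i, B w)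
    (fun i => connected_induce_biUnion hconn hadj (connected_gridBramble q i)) (by
      intro i j
      obtain ⟨u, hu, v, hv, huv⟩ := gridBramble_touch q i j
      rcases huv with rfl | huv
      · obtain ⟨x, hx⟩ := (hconn u).nonempty
        exact ⟨x, Set.mem_biUnion hu hx, x, Set.mem_biUnion hv hx, Or.inl rfl⟩
      · obtain ⟨x, hx, y, hy, hxy⟩ := hadj u v huv
        exact ⟨x, Set.mem_biUnion hu hx, y, Set.mem_biUnion hv hy, Or.inr hxy⟩)
  -- The branch sets met by the bag form a hitting set of the bramble, and each uses its own vertex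
  -- of the bag.
  let T := Finset.univ.filter fun w => ∃ x ∈ B w, x ∈ P.bag t
  have hT : q + 3 ≤ T.card := by
    refine le_card_of_meets_gridBramble q T fun i => ?_
    obtain ⟨x, hx, hxt⟩ := ht i
    obtain ⟨w, hw, hxw⟩ := Set.mem_iUnion₂.1 hx
    exact ⟨w, hw, Finset.mem_filter.2 ⟨Finset.mem_univ _, x, hxw, hxt⟩⟩
  have hle : T.card ≤ (P.bag t).card := by
    have hmem : ∀ w : T, ∃ x ∈ B w, x ∈ P.bag t := fun w => (Finset.mem_filter.1 w.2).2
    choose g hgB hgt using hmem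
    rw [← Fintype.card_coe T, ← Fintype.card_coe (P.bag t)]
    refine Fintype.card_le_of_injective (fun w => ⟨g w, hgt w⟩) fun u v huv => ?_
    have huv' : g u = g v := congrArg Subtype.val huv
    by_contra hne
    exact Set.disjoint_left.1 (hdisj u v fun h => hne (Subtype.ext h)) (hgB u) (huv' ▸ hgB v)
  have := P.card_bag_le t
  push_cast
  omega

/-! ### Coordinates relative to a corner -/

/-- The distance of `i` from the end of `{0, …, n - 1}` selected by `a`. -/
def endDist {n : ℕ} (a : Bool) (i : Fin n) : ℕ := if a then i.rev else i

theorem endDist_lt {n : ℕ} (a : Bool) (i : Fin n) : endDist a i < n := by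
  unfold endDist
  split_ifs <;> exact Fin.isLt _

theorem endDist_injective {n : ℕ} (a : Bool) :
    Function.Injective (endDist a : Fin n → ℕ) := by
  intro i j h
  cases a
  · simpa [endDist, Fin.ext_iff] using h
  · simp only [endDist, if_true, Fin.val_inj] at h
    exact Fin.rev_injective h

theorem exists_endDist_eq {n : ℕ} (a : Bool) {c : ℕ} (hc : c < n) :
    ∃ i : Fin n, endDist a i = c := by
  cases a
  · exact ⟨⟨c, hc⟩, by simp [endDist]⟩
  · exact ⟨Fin.rev ⟨c, hc⟩, by simp [endDist]⟩

theorem pathGraph_adj_endDist {n : ℕ} (a : Bool) (i j : Fin n) :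
    (pathGraph n).Adj i j ↔
      endDist a i + 1 = endDist a j ∨ endDist a j + 1 = endDist a i := by
  have := i.isLt
  have := j.isLt
  cases a <;> simp only [pathGraph_adj, endDist, if_true, Bool.false_eq_true, if_false, Fin.val_rev]
  omega

theorem gridGraph_adj_endDist {n : ℕ} (a b : Bool) (u v : Fin n × Fin n) :
    (gridGraph n).Adj u v ↔
      (endDist a u.1 = endDist a v.1 ∧
        (endDist b u.2 + 1 = endDist b v.2 ∨ endDist b v.2 + 1 = endDist b u.2)) ∨
      (endDist b u.2 = endDist b v.2 ∧
        (endDist a u.1 + 1 = endDist a v.1 ∨ endDist a v.1 + 1 = endDist a u.1)) := by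
  simp only [gridGraph, boxProd_adj, pathGraph_adj_endDist a u.1, pathGraph_adj_endDist b u.2,
    (endDist_injective _).eq_iff]
  tauto

theorem mem_cornerDiagonal {n m : ℕ} (a b : Bool) (v : Fin n × Fin n) :
    v ∈ cornerDiagonal n m a b ↔ endDist a v.1 = endDist b v.2 ∧ endDist a v.1 < m := by
  obtain ⟨i, j⟩ := v
  simp only [cornerDiagonal, Finset.mem_image, Finset.mem_filter, Finset.mem_univ, true_and,
    Prod.mk.injEq]
  constructor
  · rintro ⟨c, hc, rfl, rfl⟩
    have key : ∀ d : Bool, endDist d (if d then c.rev else c) = c := by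
      intro d
      cases d <;> simp [endDist]
    rw [key, key]
    exact ⟨rfl, hc⟩
  · rintro ⟨h1, h2⟩
    have key : ∀ (d : Bool) (x c : Fin n), endDist d x = c → (if d then c.rev else c) = x := by
      intro d x c h
      cases d
      · simpa [endDist, Fin.ext_iff] using h.symm
      · simp only [endDist, if_true, Fin.val_inj] at h
        simp [← h]
    exact ⟨⟨endDist a i, endDist_lt a i⟩, h2, key a i _ rfl, key b j _ h1.symm⟩

theorem card_cornerDiagonal {n m : ℕ} (hm : m ≤ n) (a b : Bool) :
    (cornerDiagonal n m a b).card = m := by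
  rw [cornerDiagonal, Finset.card_image_of_injective]
  · rw [Fin.card_filter_val_lt, min_eq_right hm]
  · intro i j h
    have h1 := congrArg Prod.fst h
    cases a <;> simpa using h1

/-! ### Upper bound: rotating around the end of the diagonal -/

theorem exists_pathDecomposition_damagedGrid {n m : ℕ} (hm : 2 * m ≤ n) (a b : Bool) :
    ∃ P : PathDecomposition (damagedGrid n (cornerDiagonal n m a b)),
      P.width ≤ ((n - m : ℕ) : ℤ) := by
  let x : {v // v ∉ cornerDiagonal n m a b} → ℕ := fun v => endDist a v.1.1
  let y : {v // v ∉ cornerDiagonal n m a b} → ℕ := fun v => endDist b v.1.2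
  have hx : ∀ v, x v < n := fun v => endDist_lt a _
  have hy : ∀ v, y v < n := fun v => endDist_lt b _
  have hD : ∀ v, x v = y v → m ≤ x v := by
    intro v h
    by_contra! h'
    exact v.2 ((mem_cornerDiagonal a b v.1).2 ⟨h, h'⟩)
  have hext : ∀ u v, x u = x v → y u = y v → u = v := fun u v h1 h2 =>
    Subtype.ext (Prod.ext (endDist_injective a h1) (endDist_injective b h2))
  have hadj : ∀ u v, (damagedGrid n (cornerDiagonal n m a b)).Adj u v →
      (x u = x v ∧ (y u + 1 = y v ∨ y v + 1 = y u)) ∨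
      (y u = y v ∧ (x u + 1 = x v ∨ x v + 1 = x u)) :=
    fun u v h => (gridGraph_adj_endDist a b u.1 v.1).1 h
  clear_value x y
  -- The lane is the index of the ring, and the four cases are its sides in the order of the sweep,
  -- which turns at the diagonal and at the antidiagonal near x + y = 2m. The offsets n, 3n, 5n put
  -- the sides into disjoint, increasing time windows.
  obtain ⟨time, lane, hstage⟩ : ∃ time lane : {v // v ∉ cornerDiagonal n m a b} → ℕ, ∀ v,
      (x v < y v ∧ x v + y v < 2 * m ∧ time v = y v ∧ lane v + x v + 1 = m) ∨
      (x v ≤ y v ∧ 2 * m ≤ x v + y v ∧ time v = n + x v ∧ lane v + m = y v) ∨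
      (y v < x v ∧ 2 * m ≤ x v + y v + 1 ∧ time v + y v = 3 * n ∧ lane v + m = x v) ∨
      (y v < x v ∧ x v + y v + 1 < 2 * m ∧ time v + x v = 5 * n ∧ lane v + y v + 1 = m) := by
    refine ⟨fun v => if x v ≤ y v then (if x v + y v < 2 * m then y v else n + x v)
        else (if 2 * m ≤ x v + y v + 1 then 3 * n - y v else 5 * n - x v),
      fun v => max (m - 1 - min (x v) (y v)) (max (x v) (y v) - m), fun v => ?_⟩
    have := hx v
    have := hy v
    have := hD v
    dsimp only
    split_ifs <;> omega
  refine exists_pathDecomposition_width_le _ _ time lane (fun v => ?_) (fun u v hl ht => ?_)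
    (fun u v w hl ht huw => ?_)
  · have := hx v
    have := hy v
    have := hstage v
    omega
  · have hxu := hx u
    have hyu := hy u
    have hxv := hx v
    have hyv := hy v
    apply hext <;> rcases hstage u with h | h | h | h <;> rcases hstage v with h' | h' | h' | h' <;>
      omega
  · have hxu := hx u
    have hyu := hy u
    have hxv := hx v
    have hyv := hy v
    have hxw := hx w
    have hyw := hy w
    have hadj := hadj u w huw
    by_cases hwv : x w = x v ∧ y w = y v
    · exact Or.inl (hext w v hwv.1 hwv.2)
    right
    rcases hstage u with h | h | h | h <;> rcases hstage v with h' | h' | h' | h' <;>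
      first
      | omega
      | rcases hstage w with h'' | h'' | h'' | h'' <;> omega

/-! ### Lower bound and conclusion -/

theorem isGraphMinor_damagedGrid {n m : ℕ} (a b : Bool) :
    IsGraphMinor (gridGraph (n - m)) (damagedGrid n (cornerDiagonal n m a b)) := by
  have hex : ∀ (d : Bool) (i : Fin (n - m)), ∃ j : Fin n, endDist d j = m + i := fun d i =>
    exists_endDist_eq d (by omega)
  choose g hg using hex
  have hmem : ∀ w : Fin (n - m) × Fin (n - m), (g a w.1, g b w.2) ∉ cornerDiagonal n m a b := by
    intro w
    rw [mem_cornerDiagonal]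
    simp only [hg]
    omega
  -- Singleton branch sets: the subgrid with both corner distances at least `m` avoids the deleted
  -- vertices.
  refine ⟨fun w => {⟨(g a w.1, g b w.2), hmem w⟩}, fun w => ?_, fun u w huw => ?_,
    fun u w huw => ⟨_, rfl, _, rfl, ?_⟩⟩
  · exact connected_induce_of_descent _ _ _ rfl (fun _ => 0) fun v hv hne => absurd hv hne
  · rw [Set.disjoint_singleton]
    intro h
    apply huw
    simp only [Subtype.mk.injEq, Prod.mk.injEq] at h
    have h1 := congrArg (endDist a) h.1
    have h2 := congrArg (endDist b) h.2
    simp only [hg] at h1 h2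
    exact Prod.ext (Fin.ext (by omega)) (Fin.ext (by omega))
  · rw [gridGraph_adj] at huw
    refine (gridGraph_adj_endDist a b (g a u.1, g b u.2) (g a w.1, g b w.2)).2 ?_
    simp only [hg]
    omega

theorem le_width_damagedGrid {n m : ℕ} (hm : 2 * m ≤ n) (hn : 2 ≤ n) (a b : Bool)
    (P : PathDecomposition (damagedGrid n (cornerDiagonal n m a b))) :
    ((n - m : ℕ) : ℤ) ≤ P.width := by
  by_cases hk : 2 ≤ n - m
  · exact (isGraphMinor_damagedGrid a b).le_width hk P
  -- The bramble bound fails for the 1 × 1 grid. In this one remaining case an edge forces a bag of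
  -- two vertices.
  obtain ⟨rfl, rfl⟩ : n = 2 ∧ m = 1 := by omega
  obtain ⟨i, hi⟩ := exists_endDist_eq (n := 2) a (c := 0) (by omega)
  obtain ⟨i', hi'⟩ := exists_endDist_eq (n := 2) a (c := 1) (by omega)
  obtain ⟨j, hj⟩ := exists_endDist_eq (n := 2) b (c := 1) (by omega)
  have hu : (i, j) ∉ cornerDiagonal 2 1 a b := by
    rw [mem_cornerDiagonal]; dsimp only; omega
  have hv : (i', j) ∉ cornerDiagonal 2 1 a b := by
    rw [mem_cornerDiagonal]; dsimp only; omega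
  have hadj : (damagedGrid 2 (cornerDiagonal 2 1 a b)).Adj ⟨_, hu⟩ ⟨_, hv⟩ :=
    (gridGraph_adj_endDist a b (i, j) (i', j)).2 (by dsimp only; omega)
  obtain ⟨t, hut, hvt⟩ := P.exists_adj _ _ hadj
  have h1 := Finset.one_lt_card.2 ⟨_, hut, _, hvt, hadj.ne⟩
  have h2 := P.card_bag_le t
  push_cast
  omega

theorem mainTheorem4 (n m : ℕ) (hm : 2 * m ≤ n) (a b : Bool) :
    (cornerDiagonal n m a b).card = m ∧
    (2 ≤ n → HasPathwidth (damagedGrid n (cornerDiagonal n m a b)) ((n : ℤ) - (m : ℤ))) ∧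
    IsGreatest {k : ℕ | IsGraphMinor (gridGraph k) (damagedGrid n (cornerDiagonal n m a b))}
      (n - m) := by
  obtain ⟨P, hP⟩ := exists_pathDecomposition_damagedGrid hm a b
  refine ⟨card_cornerDiagonal (by omega) a b, fun hn => ?_, isGraphMinor_damagedGrid a b,
    fun k hk => ?_⟩
  · rw [← Nat.cast_sub (by omega)]
    refine ⟨⟨P, le_antisymm hP (le_width_damagedGrid hm hn a b P)⟩, ?_⟩
    rintro _ ⟨Q, rfl⟩
    exact le_width_damagedGrid hm hn a b Q
  · by_cases h2 : 2 ≤ k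
    · exact_mod_cast (IsGraphMinor.le_width h2 hk P).trans hP
    -- For k = 1 the minor only supplies a vertex, so n > 0, and 2m ≤ n then gives n - m ≥ 1.
    · rcases Nat.eq_zero_or_pos k with rfl | hpos
      · exact Nat.zero_le _
      · obtain ⟨B, hconn, -, -⟩ := hk
        obtain ⟨⟨v, -⟩⟩ := (hconn (⟨0, hpos⟩, ⟨0, hpos⟩)).nonempty
        have := v.1.1.isLt
        omega
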